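/- Let $N\ge 1$, let $T:\mathbb{R}_+^N\to\mathbb{R}_{++}^N$ be a continuous mapping that is concave with respect to the entrywise order, and write $T=[t_1,\ldots,t_N]$. Here $\mathbb{R}_+$ and $\mathbb{R}_{++}$ denote the nonnegative and the positive reals. Let $\|\cdot\|_a$ and $\|\cdot\|_b$ be monotone norms on $\mathbb{R}^N$, i.e., norms such that $\mathbf{0}\le\mathbf{y}\le\mathbf{x}$ (entrywise) implies $\|\mathbf{y}\|\le\|\mathbf{x}\|$. For every power budget $\bar p>0$ consider the problem $$\text{maximize } c\quad\text{subject to}\quad \mathbf{p}=c\,T(\mathbf{p}),\quad \|\mathbf{p}\|_a\le\bar p,\quad \mathbf{p}\in\mathbb{R}_+^N,\ c\in\mathbb{R}_{++}.$$ This problem has exactly one solution, denoted by $(P(\bar p),U(\bar p))$; the $\|\cdot\|_b$-energy efficiency function is $E(\bar p):=U(\bar p)/\|P(\bar p)\|_b$. The limits $[\mathbf{M}]_{i,j}:=\lim_{h\to0^+}h\,t_i(h^{-1}\mathbf{e}_j)$ exist, where $\mathbf{e}_j$ is the $j$th standard unit vector; they are the entries of the lower bounding matrix $\mathbf{M}\in\mathbb{R}^{N\times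 N}$ of $T$, and $\rho(\mathbf{M})$ denotes its spectral radius. Let $\mathbf{1}$ be the vector of ones. Then the following hold. (i) (Lower bound) Let $\alpha_1>0$ satisfy $\alpha_1\|\mathbf{p}\|_b\le\|\mathbf{p}\|_a$ for every $\mathbf{p}\in\mathbb{R}^N$, and let $\beta>0$ satisfy $\|\mathbf{p}\|_\infty\le\beta\|\mathbf{p}\|_a$ for every $\mathbf{p}\in\mathbb{R}_{++}^N$. Then $\dfrac{\alpha_1}{\|T(\bar p\beta\mathbf{1})\|_a}\le E(\bar p)$ for every $\bar p>0$. (ii) (Upper bound) Assume that $\rho(\mathbf{M})>0$, and let $\alpha_2>0$ satisfy $\|\mathbf{p}\|_a\le\alpha_2\|\mathbf{p}\|_b$ for every $\mathbf{p}\in\mathbb{R}^N$. Then $E(\bar p)<\dfrac{\alpha_2}{\rho(\mathbf{M})\,\bar p}$ for every $\bar p>0$. (iii) (Maximum energy efficiency) $\displaystyle\lim_{\bar p\to0^+}E(\bar p)=\sup_{\bar p>0}E(\bar p)=\frac{1}{\|T(\mathbf{0})\|_b}$. (iv) (Combined upper bound) Assume that $\rho(\mathbf{M})>0$, let $\alpha_2$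 be as in (ii), and set $k:=\|T(\mathbf{0})\|_b/\rho(\mathbf{M})$. Then, for every $\bar p>0$, $E(\bar p)\le\dfrac{\alpha_2}{\rho(\mathbf{M})\,\bar p}$ if $\bar p\ge k$, and $E(\bar p)\le\dfrac{1}{\|T(\mathbf{0})\|_b}$ otherwise. -/

import Mathlib

open Set Filter Topology

namespace EnergyEfficiency

/-- A seminorm on `ℝ^N` is a monotone norm if it is definite and order preserving on the
nonnegative orthant. -/
def IsMonotoneNorm {N : ℕ} (a : Seminorm ℝ (Fin N → ℝ)) : Prop :=
  (∀ x, a x = 0 → x = 0) ∧ ∀ x y : Fin N → ℝ, 0 ≤ y → y ≤ x → a y ≤ a x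

/-- Continuous concave mappings `T : ℝ₊^N → ℝ₊₊^N`. Here `T` is a total function of which only the
values on the nonnegative orthant `Set.Ici 0` matter; the order is the entrywise one. -/
structure IsInterferenceMapping {N : ℕ} (T : (Fin N → ℝ) → (Fin N → ℝ)) : Prop where
  pos : ∀ x, 0 ≤ x → ∀ i, 0 < T x i
  continuousOn : ContinuousOn T (Ici 0)
  concaveOn : ConcaveOn ℝ (Ici 0) T

/-- The pairs `(p, c)` with `p ∈ ℝ₊^N`, `c > 0`, `p = c T(p)` and `‖p‖_a ≤ pbar`. -/
def feasibleSet {N : ℕ} (T : (Fin N → ℝ) → (Fin N → ℝ)) (a : Seminorm ℝ (Fin N → ℝ))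
    (pbar : ℝ) : Set ((Fin N → ℝ) × ℝ) :=
  {s | 0 ≤ s.1 ∧ 0 < s.2 ∧ s.1 = s.2 • T s.1 ∧ a s.1 ≤ pbar}

/-- `s = (p, c)` solves the canonical problem: it is feasible and maximizes `c`. -/
def IsSolution {N : ℕ} (T : (Fin N → ℝ) → (Fin N → ℝ)) (a : Seminorm ℝ (Fin N → ℝ))
    (pbar : ℝ) (s : (Fin N → ℝ) × ℝ) : Prop :=
  s ∈ feasibleSet T a pbar ∧ ∀ s' ∈ feasibleSet T a pbar, s'.2 ≤ s.2

/-- The solution of the canonical problem with power budget `pbar`. -/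
noncomputable def solution {N : ℕ} (T : (Fin N → ℝ) → (Fin N → ℝ))
    (a : Seminorm ℝ (Fin N → ℝ)) (pbar : ℝ) : (Fin N → ℝ) × ℝ :=
  Classical.epsilon (IsSolution T a pbar)

/-- The power function `P`. -/
noncomputable def power {N : ℕ} (T : (Fin N → ℝ) → (Fin N → ℝ))
    (a : Seminorm ℝ (Fin N → ℝ)) (pbar : ℝ) : Fin N → ℝ :=
  (solution T a pbar).1

/-- The utility function `U`. -/
noncomputable def utility {N : ℕ} (T : (Fin N → ℝ) → (Fin N → ℝ))
    (a : Seminorm ℝ (Fin N → ℝ)) (pbar : ℝ) : ℝ :=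
  (solution T a pbar).2

/-- The `‖·‖_b`-energy efficiency function `E(pbar) = U(pbar) / ‖P(pbar)‖_b`. -/
noncomputable def energyEfficiency {N : ℕ} (T : (Fin N → ℝ) → (Fin N → ℝ))
    (a b : Seminorm ℝ (Fin N → ℝ)) (pbar : ℝ) : ℝ :=
  utility T a pbar / b (power T a pbar)

/-- The lower bounding matrix, with entries `lim_{h → 0⁺} h t_i(h⁻¹ e_j)`. -/
noncomputable def lowerBoundingMatrix {N : ℕ} (T : (Fin N → ℝ) → (Fin N → ℝ)) :
    Matrix (Fin N) (Fin N) ℝ :=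
  Matrix.of fun i j => limUnder (𝓝[>] (0 : ℝ)) fun h : ℝ => h * T (h⁻¹ • Pi.single j 1) i

/-- The spectral radius of a real matrix: the largest modulus of its complex eigenvalues. -/
noncomputable def specRadius {N : ℕ} (M : Matrix (Fin N) (Fin N) ℝ) : ℝ :=
  (spectralRadius ℂ (M.map (fun x : ℝ => (x : ℂ)))).toReal

end EnergyEfficiency

namespace EnergyEfficiency

variable {N : ℕ} {T : (Fin N → ℝ) → (Fin N → ℝ)} {a : Seminorm ℝ (Fin N → ℝ)}

/-! Positivity and concavity make `T` monotone and strictly scalable: `T (s x) < s T x` for `s > 1`.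
Relaxing `p = c T p` to `c T p ≤ p` gives a compact problem with the same optimal `c`; strict
scalability makes the fixed point for each `c` unique and the power constraint active, `‖P‖_a =
pbar` (`norm_power_eq`). Since `P = U T(P)`, the utility cancels and `E = 1 / ‖T(P)‖_b`
(`energyEfficiency_eq`). Hence (i) follows from `P ≤ pbar β 1`, and (iii) from `0 ≤ P` together with
`P → 0` as `pbar → 0`. For (ii), concavity gives `M p < T p`, so `U M P < P` in every coordinate,
and a Collatz–Wielandt bound yields `U ρ(M) < 1`; then use `‖P‖_b ≥ pbar / α₂`. -/

lemma IsInterferenceMapping.nonneg (hT : IsInterferenceMapping T) {x : Fin N → ℝ} (hx : 0 ≤ x) :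
    0 ≤ T x := fun i => (hT.pos x hx i).le

/-- A nonnegative concave mapping on the orthant is monotone. -/
lemma IsInterferenceMapping.mono (hT : IsInterferenceMapping T) {x y : Fin N → ℝ} (hx : 0 ≤ x)
    (hxy : x ≤ y) : T x ≤ T y := by
  intro i
  have key : ∀ ε ∈ Ioo (0 : ℝ) 1, (1 - ε) * T x i ≤ T y i := by
    rintro ε ⟨h0, h1⟩
    -- `y` is the convex combination, with weight `ε` on this far point, whose nonnegative
    -- contribution can be dropped; then `ε → 0`.
    have hz : 0 ≤ x + ε⁻¹ • (y - x) :=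
      add_nonneg hx (smul_nonneg (inv_nonneg.2 h0.le) (sub_nonneg.2 hxy))
    have h := hT.concaveOn.2 hx hz (sub_nonneg.2 h1.le) h0.le (sub_add_cancel 1 ε) i
    have e : (1 - ε) • x + ε • (x + ε⁻¹ • (y - x)) = y := by
      rw [smul_add, smul_smul, mul_inv_cancel₀ h0.ne', one_smul, sub_smul, one_smul]
      abel
    rw [e] at h
    simp only [Pi.add_apply, Pi.smul_apply, smul_eq_mul] at h
    have := mul_pos h0 (hT.pos _ hz i)
    linarith
  have lim : Tendsto (fun ε : ℝ => (1 - ε) * T x i) (𝓝[>] 0) (𝓝 ((1 - 0) * T x i)) :=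
    (Continuous.tendsto (by fun_prop) 0).mono_left nhdsWithin_le_nhds
  have := le_of_tendsto lim
    (eventually_of_mem (Ioo_mem_nhdsGT one_pos) key)
  simpa using this

/-- Strict scalability. -/
lemma IsInterferenceMapping.smul_lt (hT : IsInterferenceMapping T) {x : Fin N → ℝ} (hx : 0 ≤ x)
    {s : ℝ} (hs : 1 < s) (i : Fin N) : T (s • x) i < s * T x i := by
  have s0 : 0 < s := one_pos.trans hs
  -- `x` is the combination of `s x` and `0` with weights `s⁻¹` and `1 - s⁻¹`; strictness comes from
  -- `T 0 > 0`.
  have h := hT.concaveOn.2 (x := s • x) (y := 0) (smul_nonneg s0.le hx) (mem_Ici.2 le_rfl)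
    (inv_nonneg.2 s0.le) (sub_nonneg.2 (inv_le_one_of_one_le₀ hs.le)) (by ring) i
  rw [smul_smul, inv_mul_cancel₀ s0.ne', one_smul, smul_zero, add_zero] at h
  simp only [Pi.add_apply, Pi.smul_apply, smul_eq_mul] at h
  have h2 := mul_pos (sub_pos.2 (inv_lt_one_of_one_lt₀ hs)) (hT.pos 0 le_rfl i)
  have h3 : s⁻¹ * T (s • x) i < T x i := by linarith
  calc T (s • x) i = s * (s⁻¹ * T (s • x) i) := by field_simp
    _ < s * T x i := mul_lt_mul_of_pos_left h3 s0

/-! ### Monotone norms -/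

lemma continuous_seminorm (a : Seminorm ℝ (Fin N → ℝ)) : Continuous a :=
  continuousOn_univ.1 (a.convexOn.continuousOn isOpen_univ)

lemma IsMonotoneNorm.pos (ha : IsMonotoneNorm a) {x : Fin N → ℝ} (hx : x ≠ 0) : 0 < a x :=
  lt_of_le_of_ne (apply_nonneg a x) fun h => hx (ha.1 x h.symm)

lemma IsMonotoneNorm.single_pos (ha : IsMonotoneNorm a) (i : Fin N) :
    0 < a (Pi.single i 1) :=
  ha.pos (by simp)

lemma IsMonotoneNorm.apply_le (ha : IsMonotoneNorm a) {x : Fin N → ℝ} (hx : 0 ≤ x) (i : Fin N) :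
    x i ≤ a x / a (Pi.single i 1) := by
  rw [le_div_iff₀ (ha.single_pos i)]
  have h : a (x i • Pi.single i (1 : ℝ)) ≤ a x := by
    refine ha.2 _ _ (smul_nonneg (hx i) (Pi.single_nonneg.2 zero_le_one)) fun j => ?_
    rcases eq_or_ne j i with rfl | h
    · simp
    · simpa [h] using hx j
  rwa [map_smul_eq_mul, Real.norm_of_nonneg (hx i)] at h

lemma IsInterferenceMapping.ne_zero (hN : 0 < N) (hT : IsInterferenceMapping T) {x : Fin N → ℝ}
    (hx : 0 ≤ x) : T x ≠ 0 := fun h => (hT.pos x hx ⟨0, hN⟩).ne' (congrFun h _)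

/-! ### Existence of solutions through the relaxed problem -/

/-- The relaxed feasible set, where `p = c T(p)` is replaced by `c T(p) ≤ p`. -/
def relaxedSet (T : (Fin N → ℝ) → (Fin N → ℝ)) (a : Seminorm ℝ (Fin N → ℝ)) (pbar : ℝ) :
    Set ((Fin N → ℝ) × ℝ) :=
  {s | 0 ≤ s.1 ∧ 0 ≤ s.2 ∧ s.2 • T s.1 ≤ s.1 ∧ a s.1 ≤ pbar}

lemma feasibleSet_subset_relaxedSet (pbar : ℝ) : feasibleSet T a pbar ⊆ relaxedSet T a pbar :=
  fun _ h => ⟨h.1, h.2.1.le, h.2.2.1.ge, h.2.2.2⟩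

lemma isCompact_relaxedSet (hN : 0 < N) (hT : IsInterferenceMapping T) (ha : IsMonotoneNorm a)
    (pbar : ℝ) : IsCompact (relaxedSet T a pbar) := by
  have hT0 : 0 < a (T 0) := ha.pos (hT.ne_zero hN le_rfl)
  have hsub : relaxedSet T a pbar ⊆
      Icc (0 : (Fin N → ℝ) × ℝ) (fun i => pbar / a (Pi.single i 1), pbar / a (T 0)) := by
    rintro ⟨p, c⟩ ⟨h1, h2, h3, h4⟩
    refine ⟨⟨h1, h2⟩, fun i => (ha.apply_le h1 i).trans ?_, ?_⟩
    · exact div_le_div_of_nonneg_right h4 (ha.single_pos i).le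
    · change c ≤ _
      rw [le_div_iff₀ hT0]
      calc c * a (T 0) = a (c • T 0) := by rw [map_smul_eq_mul, Real.norm_of_nonneg h2]
        _ ≤ a p := ha.2 _ _ (smul_nonneg h2 (hT.nonneg le_rfl))
            ((smul_le_smul_of_nonneg_left (hT.mono le_rfl h1) h2).trans h3)
        _ ≤ pbar := h4
  refine isCompact_Icc.of_isClosed_subset ?_ hsub
  have hD : IsClosed {s : (Fin N → ℝ) × ℝ | 0 ≤ s.1} := isClosed_le continuous_const continuous_fst
  have hc : ContinuousOn (fun s : (Fin N → ℝ) × ℝ => s.1 - s.2 • T s.1) {s | 0 ≤ s.1} :=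
    continuousOn_fst.sub
      (continuousOn_snd.smul (hT.continuousOn.comp continuousOn_fst fun _ h => h))
  have h1 := hc.preimage_isClosed_of_isClosed hD (isClosed_Ici (a := (0 : Fin N → ℝ)))
  have h2 : IsClosed {s : (Fin N → ℝ) × ℝ | 0 ≤ s.2} := isClosed_le continuous_const continuous_snd
  have h3 : IsClosed {s : (Fin N → ℝ) × ℝ | a s.1 ≤ pbar} :=
    isClosed_le ((continuous_seminorm a).comp continuous_fst) continuous_const
  convert (h1.inter h2).inter h3 using 1
  ext s
  simp only [relaxedSet, mem_ofPred_eq, mem_inter_iff, mem_preimage, mem_Ici, sub_nonneg]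
  tauto

/-- If `c T(p) ≤ y` has strict slack in every coordinate, then `c` can be increased. -/
lemma exists_gt_smul_le {x y : Fin N → ℝ} {c : ℝ} (h : ∀ i, c * x i < y i) :
    ∃ c', c < c' ∧ c' • x ≤ y := by
  have h1 : ∀ᶠ d in 𝓝[>] c, ∀ i, d * x i < y i := by
    refine eventually_all.2 fun i => ?_
    have hc : Tendsto (fun d : ℝ => d * x i) (𝓝[>] c) (𝓝 (c * x i)) :=
      (Continuous.tendsto (by fun_prop) c).mono_left nhdsWithin_le_nhds
    exact hc.eventually_lt_const (h i)
  obtain ⟨d, hd, hcd⟩ := (h1.and self_mem_nhdsWithin).exists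
  exact ⟨d, hcd, fun i => (hd i).le⟩

lemma exists_pos_mem_relaxedSet (hN : 0 < N)
    (ha : IsMonotoneNorm a) {pbar : ℝ} (hp : 0 < pbar) :
    ∃ s ∈ relaxedSet T a pbar, 0 < s.2 := by
  have h1 : 0 < a (1 : Fin N → ℝ) := ha.pos fun h => one_ne_zero (congrFun h ⟨0, hN⟩)
  have h0 : 0 < pbar / a (1 : Fin N → ℝ) := div_pos hp h1
  obtain ⟨c, hc, h⟩ := exists_gt_smul_le (c := 0) (x := T ((pbar / a (1 : Fin N → ℝ)) • 1))
    (y := (pbar / a (1 : Fin N → ℝ)) • 1) fun i => by simpa using h0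
  refine ⟨(_, c), ⟨smul_nonneg h0.le zero_le_one, hc.le, h, ?_⟩, hc⟩
  rw [map_smul_eq_mul, Real.norm_of_nonneg h0.le, div_mul_cancel₀ _ h1.ne']

/-- Among the pairs with a given `c`, one with minimal total power satisfies `p = c T(p)`. -/
lemma exists_feasible_of_mem_relaxedSet (hN : 0 < N) (hT : IsInterferenceMapping T)
    (ha : IsMonotoneNorm a) {pbar : ℝ} {s : (Fin N → ℝ) × ℝ} (hs : s ∈ relaxedSet T a pbar)
    (hc : 0 < s.2) : ∃ p, (p, s.2) ∈ feasibleSet T a pbar := by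
  have hK : IsCompact (relaxedSet T a pbar ∩ {t | t.2 = s.2}) :=
    (isCompact_relaxedSet hN hT ha pbar).inter_right (isClosed_eq continuous_snd continuous_const)
  obtain ⟨⟨p, c⟩, ⟨⟨h1, h2, h3, h4⟩, rfl : c = s.2⟩, hmin⟩ :=
    hK.exists_isMinOn ⟨s, hs, rfl⟩ (f := fun t => ∑ i, t.1 i) (by fun_prop)
  dsimp only at h1 h2 h3 h4
  -- By monotonicity `c T p` satisfies the relaxed constraint again and lies below `p`; minimality
  -- of the coordinate sum forces equality.
  have q0 : 0 ≤ s.2 • T p := smul_nonneg h2 (hT.nonneg h1)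
  have hq := isMinOn_iff.1 hmin (s.2 • T p, s.2) ⟨⟨q0, h2,
    smul_le_smul_of_nonneg_left (hT.mono q0 h3) h2, (ha.2 _ _ q0 h3).trans h4⟩, rfl⟩
  have heq := (Finset.sum_eq_sum_iff_of_le fun i _ => h3 i).1
    (le_antisymm (Finset.sum_le_sum fun i _ => h3 i) hq)
  exact ⟨p, h1, hc, funext fun i => (heq i (Finset.mem_univ i)).symm, h4⟩

/-- Maximality over the relaxed set is recorded too: later arguments test optimality with pairs
satisfying only `c T p ≤ p`. -/
lemma exists_isSolution (hN : 0 < N) (hT : IsInterferenceMapping T) (ha : IsMonotoneNorm a)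
    {pbar : ℝ} (hp : 0 < pbar) :
    ∃ s, IsSolution T a pbar s ∧ ∀ t ∈ relaxedSet T a pbar, t.2 ≤ s.2 := by
  obtain ⟨s₀, hs₀, hpos⟩ := exists_pos_mem_relaxedSet hN ha hp
  obtain ⟨s, hs, hmax⟩ := (isCompact_relaxedSet hN hT ha pbar).exists_isMaxOn ⟨s₀, hs₀⟩
    continuousOn_snd
  have hmax' := isMaxOn_iff.1 hmax
  obtain ⟨p, h⟩ := exists_feasible_of_mem_relaxedSet hN hT ha hs (hpos.trans_le (hmax' _ hs₀))
  exact ⟨(p, s.2), ⟨h, fun t ht => hmax' t (feasibleSet_subset_relaxedSet _ ht)⟩, hmax'⟩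

/-! ### Uniqueness of the solution -/

/-- Weighted maximum: `v ≤ s p` with equality in some coordinate. -/
lemma exists_le_smul_eq (hN : 0 < N) (v : Fin N → ℝ) {p : Fin N → ℝ} (hp : ∀ i, 0 < p i) :
    ∃ s : ℝ, v ≤ s • p ∧ ∃ i, v i = s * p i := by
  have : Nonempty (Fin N) := ⟨⟨0, hN⟩⟩
  obtain ⟨i, hi⟩ := Finite.exists_max fun i => v i / p i
  exact ⟨v i / p i, fun j => (div_le_iff₀ (hp j)).1 (hi j), i, (div_mul_cancel₀ _ (hp i).ne').symm⟩

/-- Take the least `s` with `p ≤ s q`. If `s > 1`, then at a coordinate where they touch, `p = c T p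
≤ c T (s q) < s c T q = s q`, a contradiction. -/
lemma IsInterferenceMapping.fixedPoint_le (hN : 0 < N) (hT : IsInterferenceMapping T)
    {p q : Fin N → ℝ} {c : ℝ} (hc : 0 < c) (hp0 : 0 ≤ p) (hq0 : 0 ≤ q) (hp : p = c • T p)
    (hq : q = c • T q) : p ≤ q := by
  have hqpos : ∀ i, 0 < q i := fun i => by
    rw [hq]; exact mul_pos hc (hT.pos q hq0 i)
  obtain ⟨s, hs, i, hi⟩ := exists_le_smul_eq hN p hqpos
  rcases le_or_gt s 1 with h | h
  · exact hs.trans fun j => mul_le_of_le_one_left (hq0 j) h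
  · exfalso
    have h1 : p i = c * T p i := congrFun hp i
    have h2 : q i = c * T q i := congrFun hq i
    have h3 := (hT.mono hp0 hs i).trans_lt (hT.smul_lt hq0 h i)
    have h4 := mul_lt_mul_of_pos_left h3 hc
    rw [← h1, hi, mul_left_comm, ← h2] at h4
    exact h4.false

lemma existsUnique_isSolution (hN : 0 < N) (hT : IsInterferenceMapping T) (ha : IsMonotoneNorm a)
    {pbar : ℝ} (hp : 0 < pbar) : ∃! s, IsSolution T a pbar s := by
  obtain ⟨s, hs, -⟩ := exists_isSolution hN hT ha hp
  refine ⟨s, hs, fun t ht => ?_⟩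
  obtain ⟨p, c⟩ := s
  obtain ⟨q, d⟩ := t
  obtain rfl : d = c := le_antisymm (hs.2 _ ht.1) (ht.2 _ hs.1)
  obtain ⟨⟨p0, hd, hp, -⟩, -⟩ := hs
  obtain ⟨⟨q0, -, hq, -⟩, -⟩ := ht
  exact Prod.ext (le_antisymm (hT.fixedPoint_le hN hd q0 p0 hq hp)
    (hT.fixedPoint_le hN hd p0 q0 hp hq)) rfl

/-! ### Properties of the power and utility functions -/

lemma isSolution_solution (hN : 0 < N) (hT : IsInterferenceMapping T) (ha : IsMonotoneNorm a)
    {pbar : ℝ} (hp : 0 < pbar) : IsSolution T a pbar (solution T a pbar) :=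
  Classical.epsilon_spec (existsUnique_isSolution hN hT ha hp).exists

lemma le_utility_of_mem_relaxedSet (hN : 0 < N) (hT : IsInterferenceMapping T)
    (ha : IsMonotoneNorm a) {pbar : ℝ} (hp : 0 < pbar) {t : (Fin N → ℝ) × ℝ}
    (ht : t ∈ relaxedSet T a pbar) : t.2 ≤ utility T a pbar := by
  obtain ⟨s, hs, hmax⟩ := exists_isSolution hN hT ha hp
  exact (hmax t ht).trans ((isSolution_solution hN hT ha hp).2 _ hs.1)

lemma power_nonneg (hN : 0 < N) (hT : IsInterferenceMapping T) (ha : IsMonotoneNorm a)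
    {pbar : ℝ} (hp : 0 < pbar) : 0 ≤ power T a pbar := (isSolution_solution hN hT ha hp).1.1

lemma utility_pos (hN : 0 < N) (hT : IsInterferenceMapping T) (ha : IsMonotoneNorm a)
    {pbar : ℝ} (hp : 0 < pbar) : 0 < utility T a pbar := (isSolution_solution hN hT ha hp).1.2.1

lemma power_eq (hN : 0 < N) (hT : IsInterferenceMapping T) (ha : IsMonotoneNorm a)
    {pbar : ℝ} (hp : 0 < pbar) : power T a pbar = utility T a pbar • T (power T a pbar) :=
  (isSolution_solution hN hT ha hp).1.2.2.1

lemma power_pos (hN : 0 < N) (hT : IsInterferenceMapping T) (ha : IsMonotoneNorm a)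
    {pbar : ℝ} (hp : 0 < pbar) (i : Fin N) : 0 < power T a pbar i := by
  rw [power_eq hN hT ha hp]
  exact mul_pos (utility_pos hN hT ha hp) (hT.pos _ (power_nonneg hN hT ha hp) i)

lemma power_le (hN : 0 < N) (hT : IsInterferenceMapping T) (ha : IsMonotoneNorm a)
    {pbar : ℝ} (hp : 0 < pbar) : a (power T a pbar) ≤ pbar :=
  (isSolution_solution hN hT ha hp).1.2.2.2

/-- The power constraint is active. -/
lemma norm_power_eq (hN : 0 < N) (hT : IsInterferenceMapping T) (ha : IsMonotoneNorm a)
    {pbar : ℝ} (hp : 0 < pbar) : a (power T a pbar) = pbar := by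
  refine (power_le hN hT ha hp).antisymm (le_of_not_gt fun hlt => ?_)
  have p0 := power_nonneg hN hT ha hp
  have c0 := utility_pos hN hT ha hp
  have pe := fun i => congrFun (power_eq hN hT ha hp) i
  have hpos : 0 < a (power T a pbar) :=
    ha.pos fun h => (power_pos hN hT ha hp ⟨0, hN⟩).ne' (congrFun h _)
  -- Scaling `P` up to exhaust the budget leaves strict slack `U T (s P) < s P`, so the utility
  -- could still be increased.
  have s1 : 1 < pbar / a (power T a pbar) := (one_lt_div hpos).2 hlt
  set s := pbar / a (power T a pbar) with hs
  have s0 : 0 ≤ s := (one_pos.trans s1).le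
  obtain ⟨d, hd, h⟩ := exists_gt_smul_le (c := utility T a pbar) (x := T (s • power T a pbar))
    (y := s • power T a pbar) fun i => by
      have := mul_lt_mul_of_pos_left (hT.smul_lt p0 s1 i) c0
      rw [mul_left_comm] at this
      have e := pe i
      simp only [Pi.smul_apply, smul_eq_mul] at e ⊢
      rwa [← e] at this
  refine hd.not_ge (le_utility_of_mem_relaxedSet hN hT ha hp
    (t := (s • power T a pbar, d)) ⟨smul_nonneg s0 p0, (c0.trans hd).le, h, ?_⟩)
  rw [map_smul_eq_mul, Real.norm_of_nonneg s0, hs, div_mul_cancel₀ _ hpos.ne']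

lemma energyEfficiency_eq (hN : 0 < N) (hT : IsInterferenceMapping T) (ha : IsMonotoneNorm a)
    {pbar : ℝ} (hp : 0 < pbar) (b : Seminorm ℝ (Fin N → ℝ)) :
    energyEfficiency T a b pbar = 1 / b (T (power T a pbar)) := by
  have c0 := utility_pos hN hT ha hp
  rw [energyEfficiency]
  conv_lhs => rw [power_eq hN hT ha hp]
  rw [map_smul_eq_mul, Real.norm_of_nonneg c0.le, div_mul_eq_div_div, div_self c0.ne']

/-! ### The lower bounding matrix and its spectral radius -/

/-- The limits defining the lower bounding matrix exist and are nonnegative. -/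
lemma IsInterferenceMapping.tendsto_lowerBoundingMatrix (hT : IsInterferenceMapping T)
    (i j : Fin N) :
    Tendsto (fun h : ℝ => h * T (h⁻¹ • Pi.single j 1) i) (𝓝[>] 0)
      (𝓝 (lowerBoundingMatrix T i j)) := by
  have e0 : (0 : Fin N → ℝ) ≤ Pi.single j 1 := Pi.single_nonneg.2 zero_le_one
  -- Scalability makes this expression monotone in `h`; being bounded below by `0`, it converges as
  -- `h → 0⁺`.
  have hmono : MonotoneOn (fun h : ℝ => h * T (h⁻¹ • Pi.single j 1) i) (Ioi 0) := by
    intro h (h0 : 0 < h) k (k0 : 0 < k) hk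
    rcases hk.eq_or_lt with rfl | hk
    · exact le_rfl
    have := hT.smul_lt (smul_nonneg (inv_nonneg.2 k0.le) e0) ((one_lt_div h0).2 hk) i
    rw [smul_smul, div_mul_eq_mul_div, mul_inv_cancel₀ k0.ne', one_div] at this
    calc h * T (h⁻¹ • Pi.single j 1) i ≤ h * (k / h * T (k⁻¹ • Pi.single j 1) i) :=
          mul_le_mul_of_nonneg_left this.le h0.le
      _ = k * T (k⁻¹ • Pi.single j 1) i := by field_simp
  have hbdd : BddBelow ((fun h : ℝ => h * T (h⁻¹ • Pi.single j 1) i) '' Ioi 0) := by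
    refine ⟨0, ?_⟩
    rintro _ ⟨h, h0 : 0 < h, rfl⟩
    exact mul_nonneg h0.le (hT.nonneg (smul_nonneg (inv_nonneg.2 h0.le) e0) i)
  exact tendsto_nhds_limUnder ⟨_, hmono.tendsto_nhdsGT hbdd⟩

lemma IsInterferenceMapping.lowerBoundingMatrix_nonneg (hT : IsInterferenceMapping T)
    (i j : Fin N) : 0 ≤ lowerBoundingMatrix T i j := by
  refine ge_of_tendsto (hT.tendsto_lowerBoundingMatrix i j) ?_
  filter_upwards [self_mem_nhdsWithin] with h (h0 : 0 < h)
  exact mul_nonneg h0.le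
    (hT.nonneg (smul_nonneg (inv_nonneg.2 h0.le) (Pi.single_nonneg.2 zero_le_one)) i)

/-- Concavity is applied between `x` and `h⁻¹ e_j` with weight `t h` on the latter. The combination
`(1 - t h) x + t e_j` lies below `x + t e_j`, so monotonicity applies; then `h → 0⁺`. -/
lemma IsInterferenceMapping.add_lowerBoundingMatrix_le (hT : IsInterferenceMapping T)
    {x : Fin N → ℝ} (hx : 0 ≤ x) {t : ℝ} (ht : 0 ≤ t) (i j : Fin N) :
    T x i + lowerBoundingMatrix T i j * t ≤ T (x + Pi.single j t) i := by
  rcases ht.eq_or_lt with rfl | ht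
  · simp
  have e0 : (0 : Fin N → ℝ) ≤ Pi.single j 1 := Pi.single_nonneg.2 zero_le_one
  have l1 : Tendsto (fun h : ℝ => (1 - t * h) * T x i + h * T (h⁻¹ • Pi.single j 1) i * t) (𝓝[>] 0)
      (𝓝 ((1 - t * 0) * T x i + lowerBoundingMatrix T i j * t)) :=
    ((Continuous.tendsto (by fun_prop) 0).mono_left nhdsWithin_le_nhds).add
      ((hT.tendsto_lowerBoundingMatrix i j).mul_const t)
  rw [mul_zero, sub_zero, one_mul] at l1
  refine le_of_tendsto l1 ?_
  filter_upwards [Ioo_mem_nhdsGT (inv_pos.2 ht)] with h ⟨h0, h1⟩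
  have hth : 0 ≤ 1 - t * h := by
    have := mul_lt_mul_of_pos_left h1 ht
    rw [mul_inv_cancel₀ ht.ne'] at this
    linarith
  have hy : 0 ≤ h⁻¹ • (Pi.single j 1 : Fin N → ℝ) := smul_nonneg (inv_nonneg.2 h0.le) e0
  have h2 := hT.concaveOn.2 hx hy hth (mul_pos ht h0).le (sub_add_cancel 1 _) i
  have h3 : (1 - t * h) • x + (t * h) • h⁻¹ • (Pi.single j 1 : Fin N → ℝ) ≤
      x + Pi.single j t := by
    have e : (t * h) • h⁻¹ • (Pi.single j 1 : Fin N → ℝ) = Pi.single j t := by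
      rw [smul_smul, mul_assoc, mul_inv_cancel₀ h0.ne', mul_one, ← Pi.single_smul, smul_eq_mul,
        mul_one]
    rw [e]
    refine add_le_add_left (fun k => ?_) _
    exact mul_le_of_le_one_left (hx k) (by linarith [mul_pos ht h0])
  have h4 := hT.mono (add_nonneg (smul_nonneg hth hx) (smul_nonneg (mul_pos ht h0).le hy)) h3 i
  simp only [Pi.add_apply, Pi.smul_apply, smul_eq_mul] at h2
  linarith

/-- The lower bounding matrix bounds `T` strictly from below. -/
lemma IsInterferenceMapping.mulVec_lt (hT : IsInterferenceMapping T) {x : Fin N → ℝ}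
    (hx : 0 ≤ x) (i : Fin N) : ∑ j, lowerBoundingMatrix T i j * x j < T x i := by
  -- The vector is built up from `0` one coordinate at a time; the leftover `T 0 i > 0` makes the
  -- final inequality strict.
  have key : ∀ s : Finset (Fin N), T 0 i + ∑ j ∈ s, lowerBoundingMatrix T i j * x j ≤
      T (∑ j ∈ s, Pi.single j (x j)) i := by
    intro s
    induction s using Finset.induction_on with
    | empty => simp
    | insert j s hj ih =>
      have h := hT.add_lowerBoundingMatrix_le (x := ∑ j ∈ s, Pi.single j (x j))
        (Finset.sum_nonneg fun k _ => Pi.single_nonneg.2 (hx k)) (hx j) i j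
      rw [Finset.sum_insert hj, Finset.sum_insert hj, add_comm (Pi.single j (x j) : Fin N → ℝ)]
      linarith
  have h := key Finset.univ
  rw [Finset.univ_sum_single] at h
  linarith [hT.pos 0 le_rfl i]

/-- A Collatz–Wielandt bound. -/
lemma specRadius_le (hN : 0 < N) {M : Matrix (Fin N) (Fin N) ℝ} (hM : ∀ i j, 0 ≤ M i j)
    {p : Fin N → ℝ} (hp : ∀ i, 0 < p i) {θ : ℝ} (hθ : ∀ i, ∑ j, M i j * p j ≤ θ * p i) :
    specRadius M ≤ θ := by
  have θ0 : 0 ≤ θ := by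
    have h := (Finset.sum_nonneg fun j _ => mul_nonneg (hM ⟨0, hN⟩ j) (hp j).le).trans (hθ ⟨0, hN⟩)
    exact nonneg_of_mul_nonneg_left h (hp _)
  refine ENNReal.toReal_le_of_le_ofReal θ0 (iSup₂_le fun μ hμ => ?_)
  rw [← Matrix.spectrum_toLin', ← Module.End.hasEigenvalue_iff_mem_spectrum] at hμ
  obtain ⟨v, hv⟩ := hμ.exists_hasEigenvector
  have hMv : ∀ i, ∑ j, (M i j : ℂ) * v j = μ * v i := fun i => by
    have := congrFun hv.apply_eq_smul i
    simpa [Matrix.mulVec, dotProduct] using this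
  -- Compare the eigenvalue equation with the bound on `M p` at a coordinate where `|v| ≤ s p` is
  -- tight.
  obtain ⟨s, hs, i, hi⟩ := exists_le_smul_eq hN (fun i => ‖v i‖) hp
  have s0 : 0 < s := by
    obtain ⟨k, hk⟩ := Function.ne_iff.1 hv.2
    have h1 : 0 < s * p k := (norm_pos_iff.2 hk).trans_le (hs k)
    exact pos_of_mul_pos_left h1 (hp k).le
  have h : ‖μ‖ * (s * p i) ≤ θ * (s * p i) := by
    calc ‖μ‖ * (s * p i) = ‖∑ j, (M i j : ℂ) * v j‖ := by rw [hMv, norm_mul, ← hi]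
      _ ≤ ∑ j, M i j * ‖v j‖ := (norm_sum_le _ _).trans_eq <| Finset.sum_congr rfl fun j _ => by
          rw [norm_mul, Complex.norm_real, Real.norm_of_nonneg (hM i j)]
      _ ≤ ∑ j, M i j * (s * p j) :=
          Finset.sum_le_sum fun j _ => mul_le_mul_of_nonneg_left (hs j) (hM i j)
      _ = s * ∑ j, M i j * p j := by
          rw [Finset.mul_sum]; exact Finset.sum_congr rfl fun j _ => by ring
      _ ≤ s * (θ * p i) := mul_le_mul_of_nonneg_left (hθ i) s0.le
      _ = θ * (s * p i) := by ring
  have h' := le_of_mul_le_mul_right h (mul_pos s0 (hp i))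
  rw [ENNReal.le_ofReal_iff_toReal_le ENNReal.coe_ne_top θ0]
  simpa using h'

/-- `U M P < U T(P) = P` holds strictly in each of finitely many coordinates, so `d M P ≤ P` for
some `d > U`, whence `ρ(M) ≤ 1/d < 1/U`. -/
lemma utility_mul_specRadius_lt_one (hN : 0 < N) (hT : IsInterferenceMapping T)
    (ha : IsMonotoneNorm a) {pbar : ℝ} (hp : 0 < pbar) :
    utility T a pbar * specRadius (lowerBoundingMatrix T) < 1 := by
  have p0 := power_nonneg hN hT ha hp
  have c0 := utility_pos hN hT ha hp
  have ppos := power_pos hN hT ha hp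
  obtain ⟨d, hd, h⟩ := exists_gt_smul_le (c := utility T a pbar)
    (x := fun i => ∑ j, lowerBoundingMatrix T i j * power T a pbar j) (y := power T a pbar)
    fun i => by
      have h1 := mul_lt_mul_of_pos_left (hT.mulVec_lt p0 i) c0
      have h2 : power T a pbar i = utility T a pbar * T (power T a pbar) i :=
        congrFun (power_eq hN hT ha hp) i
      rwa [← h2] at h1
  have d0 := c0.trans hd
  have hρ : specRadius (lowerBoundingMatrix T) ≤ d⁻¹ :=
    specRadius_le hN hT.lowerBoundingMatrix_nonneg ppos fun i => by
      rw [inv_mul_eq_div, le_div_iff₀' d0]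
      exact h i
  calc utility T a pbar * specRadius (lowerBoundingMatrix T) ≤ utility T a pbar * d⁻¹ :=
        mul_le_mul_of_nonneg_left hρ c0.le
    _ < 1 := by rwa [← div_eq_mul_inv, div_lt_one d0]

/-! ### Bounds and limit of the energy efficiency -/

variable {b : Seminorm ℝ (Fin N → ℝ)}

lemma le_energyEfficiency (hN : 0 < N) (hT : IsInterferenceMapping T) (ha : IsMonotoneNorm a)
    {pbar : ℝ} (hp : 0 < pbar) (hb : IsMonotoneNorm b) {α₁ β : ℝ} (hα : 0 < α₁)
    (hab : ∀ p : Fin N → ℝ, α₁ * b p ≤ a p) (hβ : 0 < β)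
    (ha' : ∀ p : Fin N → ℝ, (∀ i, 0 < p i) → ‖p‖ ≤ β * a p) :
    α₁ / a (T ((pbar * β) • (1 : Fin N → ℝ))) ≤ energyEfficiency T a b pbar := by
  have p0 := power_nonneg hN hT ha hp
  have hle : power T a pbar ≤ (pbar * β) • (1 : Fin N → ℝ) := fun i => by
    have h1 := (le_abs_self _).trans (norm_le_pi_norm (power T a pbar) i)
    have h2 := ha' _ (power_pos hN hT ha hp)
    have h3 := mul_le_mul_of_nonneg_left (power_le hN hT ha hp) hβ.le
    simpa [mul_comm pbar] using h1.trans (h2.trans h3)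
  have h1 : 0 < b (T (power T a pbar)) := hb.pos (hT.ne_zero hN p0)
  have h2 := (hab (T (power T a pbar))).trans (ha.2 _ _ (hT.nonneg p0) (hT.mono p0 hle))
  rw [energyEfficiency_eq hN hT ha hp, div_le_div_iff₀ ((mul_pos hα h1).trans_le h2) h1, one_mul]
  exact h2

lemma energyEfficiency_lt (hN : 0 < N) (hT : IsInterferenceMapping T) (ha : IsMonotoneNorm a)
    {pbar : ℝ} (hp : 0 < pbar) (hρ : 0 < specRadius (lowerBoundingMatrix T)) {α₂ : ℝ} (hα : 0 < α₂)
    (hab : ∀ p : Fin N → ℝ, a p ≤ α₂ * b p) :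
    energyEfficiency T a b pbar < α₂ / (specRadius (lowerBoundingMatrix T) * pbar) := by
  have h1 := hab (power T a pbar)
  rw [norm_power_eq hN hT ha hp] at h1
  have h2 : 0 < b (power T a pbar) := pos_of_mul_pos_right (hp.trans_le h1) hα.le
  have h3 := utility_mul_specRadius_lt_one hN hT ha hp
  rw [energyEfficiency, div_lt_div_iff₀ h2 (mul_pos hρ hp), ← mul_assoc]
  calc _ < 1 * pbar := mul_lt_mul_of_pos_right h3 hp
    _ ≤ α₂ * b (power T a pbar) := by rwa [one_mul]

lemma energyEfficiency_le (hN : 0 < N) (hT : IsInterferenceMapping T) (ha : IsMonotoneNorm a)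
    {pbar : ℝ} (hb : IsMonotoneNorm b) (hp : 0 < pbar) :
    energyEfficiency T a b pbar ≤ 1 / b (T 0) := by
  have p0 := power_nonneg hN hT ha hp
  rw [energyEfficiency_eq hN hT ha hp]
  exact one_div_le_one_div_of_le (hb.pos (hT.ne_zero hN le_rfl))
    (hb.2 _ _ (hT.nonneg le_rfl) (hT.mono le_rfl p0))

/-- Each coordinate of `P` is squeezed between `0` and a multiple of the budget. The one-sided
target filter is needed because `T` is continuous only on the orthant. -/
lemma tendsto_power (hN : 0 < N) (hT : IsInterferenceMapping T) (ha : IsMonotoneNorm a) :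
    Tendsto (power T a) (𝓝[>] 0) (𝓝[≥] 0) := by
  have h0 : ∀ᶠ r : ℝ in 𝓝[>] 0, 0 ≤ power T a r := by
    filter_upwards [self_mem_nhdsWithin] with r hr using power_nonneg hN hT ha hr
  refine tendsto_nhdsWithin_iff.2 ⟨tendsto_pi_nhds.2 fun i => ?_, h0⟩
  have l : Tendsto (fun r : ℝ => r / a (Pi.single i 1)) (𝓝[>] 0) (𝓝 (0 / a (Pi.single i 1))) :=
    (Continuous.tendsto (by fun_prop) 0).mono_left nhdsWithin_le_nhds
  rw [zero_div] at l
  refine tendsto_of_tendsto_of_tendsto_of_le_of_le' tendsto_const_nhds l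
    (h0.mono fun r h => h i) ?_
  filter_upwards [self_mem_nhdsWithin] with r hr
  exact (ha.apply_le (power_nonneg hN hT ha hr) i).trans
    (div_le_div_of_nonneg_right (power_le hN hT ha hr) (ha.single_pos i).le)

lemma tendsto_energyEfficiency (hN : 0 < N) (hT : IsInterferenceMapping T) (ha : IsMonotoneNorm a)
    (hb : IsMonotoneNorm b) :
    Tendsto (energyEfficiency T a b) (𝓝[>] 0) (𝓝 (1 / b (T 0))) := by
  have h1 : Tendsto (fun r => 1 / b (T (power T a r))) (𝓝[>] 0) (𝓝 (1 / b (T 0))) :=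
    tendsto_const_nhds.div (((continuous_seminorm b).tendsto _).comp
      ((hT.continuousOn 0 (mem_Ici.2 le_rfl)).tendsto.comp (tendsto_power hN hT ha)))
      (hb.pos (hT.ne_zero hN le_rfl)).ne'
  refine h1.congr' ?_
  filter_upwards [self_mem_nhdsWithin] with r hr using (energyEfficiency_eq hN hT ha hr b).symm

lemma isLUB_energyEfficiency (hN : 0 < N) (hT : IsInterferenceMapping T) (ha : IsMonotoneNorm a)
    (hb : IsMonotoneNorm b) :
    IsLUB (energyEfficiency T a b '' Ioi 0) (1 / b (T 0)) := by
  refine ⟨?_, fun u hu => le_of_tendsto (tendsto_energyEfficiency hN hT ha hb) ?_⟩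
  · rintro _ ⟨r, hr, rfl⟩
    exact energyEfficiency_le hN hT ha hb hr
  · filter_upwards [self_mem_nhdsWithin] with r hr using hu ⟨r, hr, rfl⟩

end EnergyEfficiency

theorem mainTheorem3 {N : ℕ} (hN : 0 < N) (T : (Fin N → ℝ) → (Fin N → ℝ))
    (hT : EnergyEfficiency.IsInterferenceMapping T) (a b : Seminorm ℝ (Fin N → ℝ))
    (ha : EnergyEfficiency.IsMonotoneNorm a) (hb : EnergyEfficiency.IsMonotoneNorm b) :
    -- the objects are well defined: unique solvability, and existence of the limits defining `M`
    (∀ pbar : ℝ, 0 < pbar → ∃! s, EnergyEfficiency.IsSolution T a pbar s) ∧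
    (∀ i j, Tendsto (fun h : ℝ => h * T (h⁻¹ • Pi.single j 1) i) (𝓝[>] 0)
      (𝓝 (EnergyEfficiency.lowerBoundingMatrix T i j))) ∧
    -- (i) lower bound
    (∀ α₁ : ℝ, 0 < α₁ → (∀ p : Fin N → ℝ, α₁ * b p ≤ a p) →
      ∀ β : ℝ, 0 < β → (∀ p : Fin N → ℝ, (∀ i, 0 < p i) → ‖p‖ ≤ β * a p) →
      ∀ pbar : ℝ, 0 < pbar →
        α₁ / a (T ((pbar * β) • (1 : Fin N → ℝ))) ≤
          EnergyEfficiency.energyEfficiency T a b pbar) ∧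
    -- (ii) upper bound
    (0 < EnergyEfficiency.specRadius (EnergyEfficiency.lowerBoundingMatrix T) →
      ∀ α₂ : ℝ, 0 < α₂ → (∀ p : Fin N → ℝ, a p ≤ α₂ * b p) →
      ∀ pbar : ℝ, 0 < pbar →
        EnergyEfficiency.energyEfficiency T a b pbar <
          α₂ / (EnergyEfficiency.specRadius (EnergyEfficiency.lowerBoundingMatrix T) * pbar)) ∧
    -- (iii) maximum energy efficiency
    (Tendsto (EnergyEfficiency.energyEfficiency T a b) (𝓝[>] 0) (𝓝 (1 / b (T 0))) ∧
      IsLUB (EnergyEfficiency.energyEfficiency T a b '' Ioi 0) (1 / b (T 0))) ∧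
    -- (iv) combined upper bound
    (0 < EnergyEfficiency.specRadius (EnergyEfficiency.lowerBoundingMatrix T) →
      ∀ α₂ : ℝ, 0 < α₂ → (∀ p : Fin N → ℝ, a p ≤ α₂ * b p) →
      ∀ pbar : ℝ, 0 < pbar →
        EnergyEfficiency.energyEfficiency T a b pbar ≤
          if b (T 0) / EnergyEfficiency.specRadius (EnergyEfficiency.lowerBoundingMatrix T) ≤ pbar
          then α₂ / (EnergyEfficiency.specRadius (EnergyEfficiency.lowerBoundingMatrix T) * pbar)
          else 1 / b (T 0)) := by
  open EnergyEfficiency in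
  refine ⟨fun _ hp => existsUnique_isSolution hN hT ha hp, hT.tendsto_lowerBoundingMatrix,
    fun _ hα hab _ hβ hβ' _ hp => le_energyEfficiency hN hT ha hp hb hα hab hβ hβ',
    fun hρ _ hα hab _ hp => energyEfficiency_lt hN hT ha hp hρ hα hab,
    ⟨tendsto_energyEfficiency hN hT ha hb, isLUB_energyEfficiency hN hT ha hb⟩,
    fun hρ _ hα hab _ hp => ?_⟩
  -- Both bounds are valid for every budget; the threshold only selects between them.
  split_ifs
  · exact (EnergyEfficiency.energyEfficiency_lt hN hT ha hp hρ hα hab).le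
  · exact EnergyEfficiency.energyEfficiency_le hN hT ha hb hp
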